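/- **Theorem 3.7.** Let $R$ be a regular local ring (noetherian, hence a domain) with maximal ideal $\mathfrak m$ and fraction field $K$. Let $G$ be an arbitrary group, let $V$ be a $K$-vector space of finite dimension $d\ge 1$, and let $\rho_V\colon G\to\mathrm{Aut}_K(V)$ be a representation. Let $L\subset V$ be a $G$-stable $R$-lattice, that is, a finitely generated $R$-submodule spanning $V$ over $K$ with $\rho_V(g)L\subseteq L$ for all $g\in G$, and assume that $L$ is free over $R$. Write $L_{\mathfrak m}=L\otimes_R R_{\mathfrak m}$, and let $k_{\mathfrak m}=R_{\mathfrak m}/\mathfrak mR_{\mathfrak m}$ $(=R/\mathfrak m)$ be the residue field. Let $$\bar\rho_{L,\mathfrak m}\colon G\longrightarrow \mathrm{Aut}_{k_{\mathfrak m}}(L_{\mathfrak m}/\mathfrak mL_{\mathfrak m})$$ be the representation induced by the action of $G$ on $L$. If $\bar\rho_{L,\mathfrak m}$ is irreducible (its only $G$-invariant $k_{\mathfrak m}$-subspaces are $0$ and the whole space), then $\rho_V$ is irreducible (the only $G$-invariant $K$-subspaces of $V$ are $0$ and $V$). -/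

import Mathlib

open scoped TensorProduct

noncomputable section

namespace LatticeRep

/-- `ρ_L`: the representation of `G` on a `G`-stable `R`-submodule `L` of a `K`-linear
representation `V`, where `R` acts on `V` through `K`. -/
def onLattice {R K V G : Type*} [CommRing R] [Field K] [Algebra R K] [Group G]
    [AddCommGroup V] [Module R V] [Module K V] [IsScalarTower R K V]
    (ρ : Representation K G V) (L : Submodule R V)
    (hL : ∀ g : G, ∀ v ∈ L, ρ g v ∈ L) : Representation R G L where
  toFun g := ((ρ g).restrictScalars R).restrict (hL g)
  map_one' := by ext; simp
  map_mul' g h := LinearMap.ext fun x => Subtype.ext <| by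
    change ρ (g * h) x = ρ g (ρ h x)
    rw [map_mul, Module.End.mul_apply]

/-- `ρ_{L,A}`: the representation on `A ⊗[R] M` obtained by extending `σ` by `A`-linearity. -/
def extendScalars {R M G : Type*} [CommRing R] [Group G] [AddCommGroup M] [Module R M]
    (A : Type*) [CommRing A] [Algebra R A] (σ : Representation R G M) :
    Representation A G (A ⊗[R] M) where
  toFun g := (σ g).baseChange A
  map_one' := by ext; simp
  map_mul' g h := by ext; simp

/-- For `M` a module over a local ring `A` with maximal ideal `𝔪`, the quotient `M / 𝔪 M`. -/
abbrev ResidualModule (A M : Type*) [CommRing A] [IsLocalRing A] [AddCommGroup M] [Module A M] :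
    Type _ :=
  M ⧸ (IsLocalRing.maximalIdeal A • (⊤ : Submodule A M))

/-- `M / 𝔪 M` is a vector space over the residue field `A / 𝔪`. -/
instance residualModuleModule (A M : Type*) [CommRing A] [IsLocalRing A] [AddCommGroup M]
    [Module A M] : Module (IsLocalRing.ResidueField A) (ResidualModule A M) :=
  inferInstanceAs
    (Module (A ⧸ IsLocalRing.maximalIdeal A)
      (M ⧸ (IsLocalRing.maximalIdeal A • (⊤ : Submodule A M))))

theorem maximalIdeal_smul_top_le_comap {A M : Type*} [CommRing A] [IsLocalRing A]
    [AddCommGroup M] [Module A M] (f : M →ₗ[A] M) :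
    IsLocalRing.maximalIdeal A • (⊤ : Submodule A M) ≤
      (IsLocalRing.maximalIdeal A • (⊤ : Submodule A M)).comap f := by
  rw [← Submodule.map_le_iff_le_comap, Submodule.map_smul'']
  exact Submodule.smul_mono le_rfl le_top

/-- The `A / 𝔪`-linear endomorphism of `M / 𝔪 M` induced by an `A`-linear endomorphism of `M`. -/
def residualMap {A M : Type*} [CommRing A] [IsLocalRing A] [AddCommGroup M] [Module A M]
    (f : M →ₗ[A] M) :
    ResidualModule A M →ₗ[IsLocalRing.ResidueField A] ResidualModule A M where
  toFun := Submodule.mapQ _ _ f (maximalIdeal_smul_top_le_comap f)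
  map_add' := map_add _
  map_smul' c x := by
    obtain ⟨a, rfl⟩ := IsLocalRing.residue_surjective c
    exact map_smul (Submodule.mapQ _ _ f (maximalIdeal_smul_top_le_comap f)) a x

theorem residualMap_mk {A M : Type*} [CommRing A] [IsLocalRing A] [AddCommGroup M] [Module A M]
    (f : M →ₗ[A] M) (m : M) :
    residualMap f (Submodule.Quotient.mk m : ResidualModule A M) =
      (Submodule.Quotient.mk (f m) : ResidualModule A M) :=
  rfl

/-- The reduction modulo `𝔪` of a representation over a local ring `A`: the composition of the
representation with `Aut_A(M) → Aut_{A/𝔪}(M / 𝔪 M)`. -/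
def residual {A M G : Type*} [CommRing A] [IsLocalRing A] [AddCommGroup M] [Module A M] [Group G]
    (σ : Representation A G M) :
    Representation (IsLocalRing.ResidueField A) G (ResidualModule A M) where
  toFun g := residualMap (σ g)
  map_one' := LinearMap.ext fun x => by
    obtain ⟨m, rfl⟩ := Submodule.Quotient.mk_surjective _ x
    simp only [map_one, residualMap_mk, Module.End.one_apply]
  map_mul' g h := LinearMap.ext fun x => by
    obtain ⟨m, rfl⟩ := Submodule.Quotient.mk_surjective _ x
    simp only [map_mul, residualMap_mk, Module.End.mul_apply]

/-- `ρ̄_{L,𝔭}`: the reduction at a prime `𝔭` of `R`, a representation on `L_𝔭 / 𝔭 L_𝔭` over the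
residue field of `R_𝔭`, where `L_𝔭 = R_𝔭 ⊗[R] L`. -/
def reductionAt {R M G : Type*} [CommRing R] [AddCommGroup M] [Module R M] [Group G]
    (σ : Representation R G M) (p : Ideal R) [p.IsPrime] :
    Representation (IsLocalRing.ResidueField (Localization.AtPrime p)) G
      (ResidualModule (Localization.AtPrime p) (Localization.AtPrime p ⊗[R] M)) :=
  residual (extendScalars (Localization.AtPrime p) σ)

end LatticeRep

end

/-! A regular system of parameters joins 0 to the maximal ideal by primes, each p being followed by
some q = p + (x) (`IsRegularLocalRing.hasPrincipalPrimeChain_bot`). Irreducibility descends along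
this chain (`HasPrincipalPrimeChain.eq_top_or_le_smul_top`): a stable N ⊇ pM with M/N torsion-free
over R/p is pM or M. At the maximal ideal this is the hypothesis; at p = 0, applied to M = L and N =
W ∩ L for a stable subspace W, it gives W = 0 or W = V.

To pass from q to p, apply the case of q to the saturation of N + qM at q. If it is M, a
Cayley–Hamilton argument yields a ∉ q with aM ⊆ N, so N = M. If it lies in qM = pM + xM,
torsion-freeness gives N ⊆ pM + xN, and Nakayama gives N ⊆ pM. -/

open IsLocalRing

/-! ### Chains of primes -/

/-- The prime ideals of a local ring that can be joined to the maximal ideal by a chain of prime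
ideals in which every term is obtained from the preceding one by adjoining a new element. -/
inductive HasPrincipalPrimeChain {R : Type*} [CommRing R] [IsLocalRing R] : Ideal R → Prop
  | maximal : HasPrincipalPrimeChain (maximalIdeal R)
  | adjoin (p : Ideal R) (x : R) (hp : p.IsPrime) (hx : x ∈ maximalIdeal R) (hxp : x ∉ p)
      (h : HasPrincipalPrimeChain (p ⊔ Ideal.span {x})) : HasPrincipalPrimeChain p

namespace HasPrincipalPrimeChain

theorem isPrime {R : Type*} [CommRing R] [IsLocalRing R] {p : Ideal R}
    (h : HasPrincipalPrimeChain p) : p.IsPrime := by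
  cases h with
  | maximal => infer_instance
  | adjoin _ _ hp => exact hp

/-- Lifts chains from a quotient ring. Preimages contain the kernel, so adjoining a lift of x to the
preimage of p gives the preimage of p + (x). -/
theorem comap {R S : Type*} [CommRing R] [IsLocalRing R] [CommRing S] [IsLocalRing S]
    {f : R →+* S} (hf : Function.Surjective f) {p : Ideal S} (h : HasPrincipalPrimeChain p) :
    HasPrincipalPrimeChain (p.comap f) := by
  have hloc : IsLocalHom f := .of_surjective f hf
  have hcomap : (maximalIdeal S).comap f = maximalIdeal R := maximalIdeal_comap f
  induction h with
  | maximal =>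
    rw [hcomap]
    exact .maximal
  | adjoin p x hp hx hxp h ih =>
    obtain ⟨y, rfl⟩ := hf x
    refine .adjoin _ y (Ideal.comap_isPrime f p) ?_ hxp ?_
    · rwa [← hcomap]
    · convert ih using 1
      have hmap : p ⊔ Ideal.span {f y} = (p.comap f ⊔ Ideal.span {y}).map f := by
        rw [Ideal.map_sup, Ideal.map_comap_of_surjective f hf p, Ideal.map_span,
          Set.image_singleton]
      rw [hmap, Ideal.comap_map_of_surjective f hf, eq_comm, sup_eq_left]
      exact le_sup_of_le_left (Ideal.comap_mono bot_le)

end HasPrincipalPrimeChain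

/-! ### Regular parameters -/

/-- An element of a generating set of the maximal ideal can be exchanged for a given element
outside the square of the maximal ideal. -/
theorem IsLocalRing.exists_span_insert_erase_eq {R : Type*} [CommRing R] [IsLocalRing R]
    [DecidableEq R] {s : Finset R} (hs : Ideal.span (s : Set R) = maximalIdeal R) {x : R}
    (hx : x ∈ maximalIdeal R) (hx2 : x ∉ maximalIdeal R ^ 2) :
    ∃ y ∈ s, Ideal.span (insert x (s.erase y : Set R)) = maximalIdeal R := by
  have hxs := hx
  rw [← hs, Ideal.span, Submodule.mem_span_finset] at hxs
  obtain ⟨a, -, ha⟩ := hxs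
  have hsm : ∀ y ∈ s, y ∈ maximalIdeal R := fun y hy => hs ▸ Ideal.subset_span hy
  -- If every coefficient were a nonunit, x would lie in the square of the maximal ideal.
  obtain ⟨y, hy, hay⟩ : ∃ y ∈ s, IsUnit (a y) := by
    by_contra! h
    refine hx2 (ha ▸ Ideal.sum_mem _ fun y hy => ?_)
    rw [pow_two]
    exact Ideal.mul_mem_mul ((mem_maximalIdeal _).2 (h y hy)) (hsm y hy)
  refine ⟨y, hy, le_antisymm ?_ ?_⟩
  · rw [Ideal.span_le]
    rintro z (rfl | hz)
    · exact hx
    · exact hsm z (Finset.mem_of_mem_erase hz)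
  · rw [← hs, Ideal.span_le]
    intro z hz
    by_cases hzy : z = y
    · subst hzy
      rw [SetLike.mem_coe, ← Ideal.unit_mul_mem_iff_mem _ hay]
      have hsum := Finset.add_sum_erase s (fun i => a i • i) hz
      rw [ha] at hsum
      rw [← smul_eq_mul, eq_sub_of_add_eq hsum]
      refine Ideal.sub_mem _ (Ideal.subset_span (Set.mem_insert _ _)) (Ideal.sum_mem _ fun i hi => ?_)
      exact Ideal.mul_mem_left _ _ (Ideal.subset_span (Set.mem_insert_of_mem _ hi))
    · exact Ideal.subset_span (Set.mem_insert_of_mem _ (Finset.mem_erase.2 ⟨hzy, hz⟩))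

namespace IsRegularLocalRing

/-- The quotient of a regular local ring by an element outside the square of its maximal ideal is
regular, and its maximal ideal needs one generator less. -/
theorem quotient_span_singleton {R : Type*} [CommRing R] [IsRegularLocalRing R] {x : R}
    (hx : x ∈ maximalIdeal R) (hx2 : x ∉ maximalIdeal R ^ 2) :
    ∃ _ : IsRegularLocalRing (R ⧸ Ideal.span {x}),
      (maximalIdeal (R ⧸ Ideal.span {x})).spanFinrank < (maximalIdeal R).spanFinrank := by
  classical
  have hne : Ideal.span {x} ≠ ⊤ := fun h => (Ideal.IsPrime.ne_top inferInstance)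
    (top_le_iff.1 (h ▸ (Ideal.span_singleton_le_iff_mem (I := maximalIdeal R)).2 hx))
  have : Nontrivial (R ⧸ Ideal.span {x}) := Ideal.Quotient.nontrivial_iff.2 hne
  have hsurj := Ideal.Quotient.mk_surjective (I := Ideal.span {x})
  have : IsLocalRing (R ⧸ Ideal.span {x}) := .of_surjective' _ hsurj
  obtain ⟨s, hcard, hs⟩ := 
    Submodule.FG.exists_span_finset_card_eq_spanFinrank (maximalIdeal R).fg_of_isNoetherianRing
  obtain ⟨y, hy, hspan⟩ := exists_span_insert_erase_eq hs hx hx2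
  have hmax : maximalIdeal (R ⧸ Ideal.span {x}) =
      Ideal.span (Ideal.Quotient.mk (Ideal.span {x}) '' (s.erase y : Set R)) := by
    have hloc := IsLocalHom.of_surjective _ hsurj
    have hcomap : (maximalIdeal (R ⧸ Ideal.span {x})).comap (Ideal.Quotient.mk (Ideal.span {x})) =
        maximalIdeal R := maximalIdeal_comap _
    rw [← Ideal.map_comap_of_surjective _ hsurj (maximalIdeal (R ⧸ Ideal.span {x})),
      hcomap, ← hspan,
      Ideal.map_span, Set.image_insert_eq,
      Ideal.Quotient.eq_zero_iff_mem.2 (Ideal.mem_span_singleton_self x), Ideal.span_insert_zero]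
  have hle : (maximalIdeal (R ⧸ Ideal.span {x})).spanFinrank + 1 ≤ (maximalIdeal R).spanFinrank := by
    rw [← hcard, ← Finset.card_erase_add_one hy, hmax]
    refine Nat.add_le_add_right ?_ 1
    refine (Submodule.spanFinrank_span_le_ncard_of_finite (Set.toFinite _)).trans ?_
    refine (Set.ncard_image_le (Set.toFinite _)).trans ?_
    rw [Set.ncard_coe_finset]
  refine ⟨.of_spanFinrank_maximalIdeal_le _ ?_, hle⟩
  -- Dividing by x lowers the dimension by at most one and the number of generators by at least one.
  have hdim := Ideal.height_le_ringKrullDim_quotient_add_one hx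
  rw [maximalIdeal_height_eq_ringKrullDim, ← spanFinrank_maximalIdeal] at hdim
  have h : (((maximalIdeal (R ⧸ Ideal.span {x})).spanFinrank + 1 : ℕ) : WithBot ℕ∞) ≤
      ringKrullDim (R ⧸ Ideal.span {x}) + 1 := le_trans (by exact_mod_cast hle) hdim
  rw [Nat.cast_add, Nat.cast_one] at h
  exact ENat.WithBot.add_le_add_one_right_iff.1 h

/-- A regular local ring that is not a field has a parameter that avoids all minimal primes. -/
theorem exists_notMem_sq_notMem_minimalPrimes {R : Type*} [CommRing R] [IsRegularLocalRing R]
    (hR : maximalIdeal R ≠ ⊥) :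
    ∃ x ∈ maximalIdeal R, x ∉ maximalIdeal R ^ 2 ∧ ∀ q ∈ minimalPrimes R, x ∉ q := by
  by_contra! h
  have hm : ¬ maximalIdeal R ≤ maximalIdeal R ^ 2 := fun hle => hR <|
    Submodule.eq_bot_of_le_smul_of_le_jacobson_bot (maximalIdeal R) _
      (maximalIdeal R).fg_of_isNoetherianRing (by rwa [smul_eq_mul, ← pow_two])
      (maximalIdeal_le_jacobson _)
  have hcover : ((maximalIdeal R : Ideal R) : Set R) ⊆
      ⋃ q ∈ insert (maximalIdeal R ^ 2) (minimalPrimes R), (q : Set R) := by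
    intro x hx
    by_cases hx2 : x ∈ maximalIdeal R ^ 2
    · exact Set.mem_biUnion (Set.mem_insert _ _) hx2
    · obtain ⟨q, hq, hxq⟩ := h x hx hx2
      exact Set.mem_biUnion (Set.mem_insert_of_mem _ hq) hxq
  -- Prime avoidance tolerates two ideals that need not be prime; the square of the maximal ideal
  -- fills both places.
  obtain ⟨q, hq | hq, hle⟩ := (Ideal.subset_union_prime_finite (f := id)
    ((minimalPrimes.finite_of_isNoetherianRing R).insert (maximalIdeal R ^ 2))
    (maximalIdeal R ^ 2) (maximalIdeal R ^ 2)
    fun q hq hne _ => (hq.resolve_left hne).1.1).1 hcover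
  · exact hm (hq ▸ hle)
  · have hqp : q.IsPrime := hq.1.1
    have hqm : q = maximalIdeal R := le_antisymm (le_maximalIdeal hqp.ne_top) hle
    have hht := maximalIdeal_height_eq_ringKrullDim (R := R)
    rw [Ideal.height_eq_zero_iff.2 (hqm ▸ hq), ← spanFinrank_maximalIdeal] at hht
    have h0 : (maximalIdeal R).spanFinrank = 0 := by exact_mod_cast hht.symm
    exact hR ((Submodule.spanFinrank_eq_zero_iff_eq_bot
      (maximalIdeal R).fg_of_isNoetherianRing).1 h0)

/-- A prime principal ideal of a Noetherian local ring whose generator lies in no minimal prime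
forces the ring to be a domain. -/
theorem _root_.IsLocalRing.isPrime_bot_of_isPrime_span_singleton {R : Type*} [CommRing R]
    [IsLocalRing R] [IsNoetherianRing R] {x : R} (hx : (Ideal.span {x}).IsPrime)
    (hmin : ∀ q ∈ minimalPrimes R, x ∉ q) : (⊥ : Ideal R).IsPrime := by
  obtain ⟨q, hq, hqx⟩ := Ideal.exists_minimalPrimes_le (I := ⊥) (J := Ideal.span {x}) bot_le
  have hqp : q.IsPrime := hq.1.1
  suffices q = ⊥ from this ▸ hqp
  -- An element ax of q has a ∈ q, since x ∉ q; hence q = xq, and Nakayama applies.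
  refine Submodule.eq_bot_of_le_smul_of_le_jacobson_bot (Ideal.span {x}) q
    q.fg_of_isNoetherianRing (fun y hy => ?_)
    ((le_maximalIdeal hx.ne_top).trans (maximalIdeal_le_jacobson _))
  obtain ⟨a, rfl⟩ := Ideal.mem_span_singleton'.1 (hqx hy)
  rw [smul_eq_mul, mul_comm a x]
  exact Ideal.mul_mem_mul (Ideal.mem_span_singleton_self x)
    ((hqp.mem_or_mem hy).resolve_right (hmin q hq))

/-- Induction on the embedding dimension. The chain of R/(x) lifts to one starting at (x), which is
therefore prime; as x avoids the minimal primes, 0 is prime too and can be put in front. -/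
theorem hasPrincipalPrimeChain_bot (R : Type*) [CommRing R] [IsRegularLocalRing R] :
    HasPrincipalPrimeChain (⊥ : Ideal R) := by
  induction hn : (maximalIdeal R).spanFinrank using Nat.strong_induction_on generalizing R with
  | _ n ih =>
    by_cases hR : maximalIdeal R = ⊥
    · exact hR ▸ .maximal
    obtain ⟨x, hx, hx2, hmin⟩ := exists_notMem_sq_notMem_minimalPrimes hR
    obtain ⟨hreg, hlt⟩ := quotient_span_singleton hx hx2
    have hchain := (ih _ (hn ▸ hlt) (R ⧸ Ideal.span {x}) rfl).comap
      (Ideal.Quotient.mk_surjective (I := Ideal.span {x}))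
    rw [← RingHom.ker_eq_comap_bot, Ideal.mk_ker] at hchain
    have hbot := isPrime_bot_of_isPrime_span_singleton hchain.isPrime hmin
    refine .adjoin ⊥ x hbot hx (fun h => hx2 ?_) (by rwa [bot_sup_eq])
    rw [Ideal.mem_bot.1 h]
    exact zero_mem _

end IsRegularLocalRing

/-! ### Saturation at a prime and Cayley–Hamilton -/

namespace Submodule

/-- The elements of a module that some element outside the prime `q` moves into `N`. -/
def primeSaturation {R M : Type*} [CommRing R] [AddCommGroup M] [Module R M] (N : Submodule R M)
    (q : Ideal R) [hq : q.IsPrime] : Submodule R M where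
  carrier := {m | ∃ r ∉ q, r • m ∈ N}
  zero_mem' := ⟨1, hq.one_notMem, by simp⟩
  add_mem' := by
    rintro a b ⟨r, hr, ha⟩ ⟨s, hs, hb⟩
    refine ⟨r * s, hq.mul_notMem hr hs, ?_⟩
    rw [smul_add]
    refine N.add_mem ?_ ?_
    · rw [mul_comm, mul_smul]
      exact N.smul_mem s ha
    · rw [mul_smul]
      exact N.smul_mem r hb
  smul_mem' := by
    rintro c a ⟨r, hr, ha⟩
    exact ⟨r, hr, by rw [smul_comm]; exact N.smul_mem c ha⟩

theorem le_primeSaturation {R M : Type*} [CommRing R] [AddCommGroup M] [Module R M]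
    (N : Submodule R M) (q : Ideal R) [hq : q.IsPrime] : N ≤ N.primeSaturation q :=
  fun m hm => ⟨1, hq.one_notMem, by rwa [one_smul]⟩

theorem exists_forall_smul_mem_of_primeSaturation_eq_top {R M : Type*} [CommRing R]
    [AddCommGroup M] [Module R M] [Module.Finite R M] {N : Submodule R M} {q : Ideal R}
    [hq : q.IsPrime] (h : N.primeSaturation q = ⊤) : ∃ r ∉ q, ∀ m : M, r • m ∈ N := by
  obtain ⟨s, hs⟩ := Module.Finite.fg_top (R := R) (M := M)
  have hmem : ∀ m : M, ∃ r ∉ q, r • m ∈ N := fun m => (h ▸ mem_top : m ∈ N.primeSaturation q)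
  choose r hrq hr using hmem
  -- A product of multipliers over a finite generating set works for all of M.
  refine ⟨∏ m ∈ s, r m, fun hprod => ?_, fun m => ?_⟩
  · obtain ⟨m, -, hm⟩ := (hq.prod_mem_iff).1 hprod
    exact hrq m hm
  · have hm : m ∈ span R (s : Set M) := hs ▸ mem_top
    induction hm using span_induction with
    | mem y hy =>
      obtain ⟨c, hc⟩ := Finset.dvd_prod_of_mem r hy
      rw [hc, mul_comm, mul_smul]
      exact N.smul_mem c (hr y)
    | zero => simp
    | add a b _ _ ha hb => rw [smul_add]; exact N.add_mem ha hb
    | smul c a _ ha => rw [smul_comm]; exact N.smul_mem c ha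

/-- If an element outside a prime `q` maps a finite module `M` into `N + qM`, then some element
outside `q` maps `M` into `N`. -/
theorem exists_forall_smul_mem_of_forall_smul_mem_sup {R M : Type*} [CommRing R]
    [AddCommGroup M] [Module R M] [Module.Finite R M] {N : Submodule R M} {q : Ideal R}
    [hq : q.IsPrime] {r : R} (hr : r ∉ q)
    (h : ∀ m : M, r • m ∈ N ⊔ q • (⊤ : Submodule R M)) : ∃ a ∉ q, ∀ m : M, a • m ∈ N := by
  have hrange : LinearMap.range (algebraMap R (Module.End R (M ⧸ N)) r) ≤ q • ⊤ := by
    rintro _ ⟨y, rfl⟩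
    obtain ⟨m, rfl⟩ := N.mkQ_surjective y
    have hm := mem_map_of_mem (f := N.mkQ) (h m)
    rw [map_sup, map_smul'', mkQ_map_self, bot_sup_eq, map_top, range_mkQ] at hm
    rwa [Module.algebraMap_end_apply, ← map_smul]
  -- P is congruent to a power of X modulo q, so P(r) ∉ q, while P(r) kills M/N.
  obtain ⟨P, hP, -, hcoeff, hzero⟩ :=
    LinearMap.exists_monic_and_natDegree_eq_and_coeff_mem_pow_and_aeval_eq_zero R _ q hrange
  rw [Polynomial.aeval_algebraMap_apply] at hzero
  refine ⟨P.eval r, fun hmem => hr ?_, fun m => ?_⟩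
  · have hmap : P.map (Ideal.Quotient.mk q) = Polynomial.X ^ P.natDegree := by
      ext k
      rw [Polynomial.coeff_map, Polynomial.coeff_X_pow]
      split_ifs with hk
      · rw [hk, hP.coeff_natDegree, map_one]
      · rcases lt_or_gt_of_ne hk with hk | hk
        · exact Ideal.Quotient.eq_zero_iff_mem.2
            (Ideal.pow_le_self (Nat.sub_ne_zero_of_lt hk) (hcoeff k))
        · rw [Polynomial.coeff_eq_zero_of_natDegree_lt hk, map_zero]
    have heval := Polynomial.eval_map_apply (p := P) (f := Ideal.Quotient.mk q) r
    rw [hmap, Polynomial.eval_pow, Polynomial.eval_X, Ideal.Quotient.eq_zero_iff_mem.2 hmem,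
      ← map_pow, Ideal.Quotient.eq_zero_iff_mem] at heval
    exact hq.mem_of_pow_mem _ heval
  · have := LinearMap.congr_fun hzero (N.mkQ m)
    rw [Polynomial.coe_aeval_eq_eval, Module.algebraMap_end_apply, ← map_smul] at this
    simpa [← Submodule.Quotient.mk_smul] using this

end Submodule

/-! ### Descent of irreducibility along the chain -/

/-- Let `M` be a finite module with a family of endomorphisms over a local ring with maximal ideal
`𝔪`, such that `M / 𝔪 M` has no proper nonzero stable submodule. If `p` is joined to `𝔪` by a
principal prime chain, then a stable submodule containing `p M` with torsion-free quotient over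
`R / p` is `p M` or `M`. -/
theorem HasPrincipalPrimeChain.eq_top_or_le_smul_top {R M ι : Type*} [CommRing R] [IsLocalRing R]
    [IsNoetherianRing R] [AddCommGroup M] [Module R M] [Module.Finite R M]
    (f : ι → Module.End R M)
    (hirr : ∀ N : Submodule R M, (∀ i, ∀ m ∈ N, f i m ∈ N) → maximalIdeal R • ⊤ ≤ N →
      N = ⊤ ∨ N ≤ maximalIdeal R • ⊤)
    {p : Ideal R} (hp : HasPrincipalPrimeChain p) (N : Submodule R M)
    (hN : ∀ i, ∀ m ∈ N, f i m ∈ N) (hpN : p • ⊤ ≤ N)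
    (hsat : ∀ r ∉ p, ∀ m, r • m ∈ N → m ∈ N) : N = ⊤ ∨ N ≤ p • ⊤ := by
  induction hp generalizing N with
  | maximal => exact hirr N hN hpN
  | adjoin p x hprime hx hxp hq ih =>
    have hqp := hq.isPrime
    have hstable : ∀ i, ∀ m ∈ N ⊔ (p ⊔ Ideal.span {x}) • (⊤ : Submodule R M),
        f i m ∈ N ⊔ (p ⊔ Ideal.span {x}) • (⊤ : Submodule R M) := by
      intro i m hm
      have hm' := Submodule.mem_map_of_mem (f := f i) hm
      rw [Submodule.map_sup, Submodule.map_smul''] at hm'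
      exact sup_le_sup (Submodule.map_le_iff_le_comap.2 (hN i))
        (Submodule.smul_mono le_rfl le_top) hm'
    have hsatStable : ∀ i, ∀ m ∈
        (N ⊔ (p ⊔ Ideal.span {x}) • ⊤).primeSaturation (p ⊔ Ideal.span {x}),
        f i m ∈ (N ⊔ (p ⊔ Ideal.span {x}) • ⊤).primeSaturation (p ⊔ Ideal.span {x}) := by
      rintro i m ⟨r, hr, hm⟩
      exact ⟨r, hr, by rw [← map_smul]; exact hstable i _ hm⟩
    rcases ih ((N ⊔ (p ⊔ Ideal.span {x}) • ⊤).primeSaturation (p ⊔ Ideal.span {x})) hsatStable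
      (le_sup_right.trans (Submodule.le_primeSaturation _ _))
      (fun r hr m ⟨s, hs, hm⟩ => ⟨s * r, hqp.mul_notMem hs hr, by rwa [mul_smul]⟩) with h | h
    · obtain ⟨r, hr, hrm⟩ := Submodule.exists_forall_smul_mem_of_primeSaturation_eq_top h
      obtain ⟨a, ha, ham⟩ := Submodule.exists_forall_smul_mem_of_forall_smul_mem_sup hr hrm
      exact .inl (eq_top_iff.2 fun m _ =>
        hsat a (fun hap => ha (Ideal.mem_sup_left hap)) m (ham m))
    · refine .inr (Submodule.le_of_le_smul_of_le_jacobson_bot (I := Ideal.span {x})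
        (IsNoetherian.noetherian N) (((Ideal.span_singleton_le_iff_mem _).2 hx).trans
          (maximalIdeal_le_jacobson _)) fun n hn => ?_)
      have hn' := h (Submodule.le_primeSaturation _ _ (Submodule.mem_sup_left hn))
      rw [Submodule.sup_smul] at hn'
      obtain ⟨a, ha, b, hb, rfl⟩ := Submodule.mem_sup.1 hn'
      rw [Submodule.ideal_span_singleton_smul, Submodule.mem_smul_pointwise_iff_exists] at hb
      obtain ⟨m, -, rfl⟩ := hb
      refine Submodule.add_mem_sup ha (Submodule.smul_mem_smul (Ideal.mem_span_singleton_self x)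
        (hsat x hxp m ?_))
      -- The element is a + xm with a ∈ pM ⊆ N, so xm ∈ N.
      exact (N.add_mem_iff_right (hpN ha)).1 hn

/-! ### Reduction at the maximal ideal -/

theorem IsLocalRing.algebraMap_localization_maximalIdeal_bijective (R : Type*) [CommRing R]
    [IsLocalRing R] :
    Function.Bijective (algebraMap R (Localization.AtPrime (maximalIdeal R))) :=
  (IsLocalization.atUnits R (maximalIdeal R).primeCompl
    (S := Localization.AtPrime (maximalIdeal R)) (fun x hx => by simpa using! hx)).bijective

namespace LatticeRep

/-- Over a local ring `R` with maximal ideal `𝔪`, extending scalars to `R_𝔪` changes nothing. -/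
noncomputable def localizationTensorEquiv (R M : Type*) [CommRing R] [IsLocalRing R] [AddCommGroup M]
    [Module R M] : Localization.AtPrime (maximalIdeal R) ⊗[R] M ≃ₗ[R] M :=
  (TensorProduct.congr (AlgEquiv.ofBijective
    (Algebra.ofId R (Localization.AtPrime (maximalIdeal R)))
    (algebraMap_localization_maximalIdeal_bijective R)).symm.toLinearEquiv
    (LinearEquiv.refl R M)).trans (TensorProduct.lid R M)

theorem localizationTensorEquiv_symm_apply {R M : Type*} [CommRing R] [IsLocalRing R]
    [AddCommGroup M] [Module R M] (m : M) :
    (localizationTensorEquiv R M).symm m = 1 ⊗ₜ m := by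
  simp [localizationTensorEquiv]

theorem localizationTensorEquiv_extendScalars {R M G : Type*} [CommRing R] [IsLocalRing R]
    [AddCommGroup M] [Module R M] [Group G] (σ : Representation R G M) (g : G)
    (z : Localization.AtPrime (maximalIdeal R) ⊗[R] M) :
    localizationTensorEquiv R M
        (extendScalars (Localization.AtPrime (maximalIdeal R)) σ g z) =
      σ g (localizationTensorEquiv R M z) := by
  obtain ⟨m, rfl⟩ := (localizationTensorEquiv R M).symm.surjective z
  rw [LinearEquiv.apply_symm_apply, ← LinearEquiv.eq_symm_apply,
    localizationTensorEquiv_symm_apply, localizationTensorEquiv_symm_apply]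
  exact LinearMap.baseChange_tmul ..

theorem localizationTensorEquiv_mem_smul_top {R M : Type*} [CommRing R] [IsLocalRing R]
    [AddCommGroup M] [Module R M] {z : Localization.AtPrime (maximalIdeal R) ⊗[R] M}
    (hz : z ∈ maximalIdeal (Localization.AtPrime (maximalIdeal R)) •
      (⊤ : Submodule (Localization.AtPrime (maximalIdeal R))
        (Localization.AtPrime (maximalIdeal R) ⊗[R] M))) :
    localizationTensorEquiv R M z ∈ maximalIdeal R • (⊤ : Submodule R M) := by
  induction hz using Submodule.smul_induction_on' with
  | smul a ha y _ =>
    obtain ⟨r, rfl⟩ := (algebraMap_localization_maximalIdeal_bijective R).2 a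
    rw [algebraMap_smul, map_smul]
    exact Submodule.smul_mem_smul
      ((IsLocalization.AtPrime.to_map_mem_maximal_iff _ (maximalIdeal R) r).1 ha) trivial
  | add y _ z _ hy hz =>
    rw [map_add]
    exact Submodule.add_mem _ hy hz

/-- Irreducibility of the reduction at the maximal ideal, in terms of submodules of `M`. -/
theorem eq_top_or_le_smul_top_of_reductionAt_isIrreducible {R M G : Type*} [CommRing R]
    [IsLocalRing R] [AddCommGroup M] [Module R M] [Group G] (σ : Representation R G M)
    (hirr : (reductionAt σ (maximalIdeal R)).IsIrreducible) (N : Submodule R M)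
    (hN : ∀ g, ∀ m ∈ N, σ g m ∈ N) (hle : maximalIdeal R • ⊤ ≤ N) :
    N = ⊤ ∨ N ≤ maximalIdeal R • ⊤ := by
  let e := localizationTensorEquiv R M
  -- The image of N in the reduction; residue field scalars act on it because they all come from R.
  let W : Subrepresentation (reductionAt σ (maximalIdeal R)) :=
    { toSubmodule :=
        { carrier := {y | ∃ z, e z ∈ N ∧ Submodule.Quotient.mk z = y}
          zero_mem' := ⟨0, by simp, rfl⟩
          add_mem' := by
            rintro _ _ ⟨y, hy, rfl⟩ ⟨z, hz, rfl⟩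
            exact ⟨y + z, by rw [map_add]; exact N.add_mem hy hz, rfl⟩
          smul_mem' := by
            rintro c _ ⟨z, hz, rfl⟩
            obtain ⟨a, rfl⟩ := residue_surjective c
            obtain ⟨r, rfl⟩ := (algebraMap_localization_maximalIdeal_bijective R).2 a
            refine ⟨algebraMap R (Localization.AtPrime (maximalIdeal R)) r • z, ?_, rfl⟩
            rw [algebraMap_smul, map_smul]
            exact N.smul_mem r hz }
      apply_mem_toSubmodule := by
        rintro g _ ⟨z, hz, rfl⟩
        exact ⟨extendScalars (Localization.AtPrime (maximalIdeal R)) σ g z,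
          by rw [localizationTensorEquiv_extendScalars]; exact hN g _ hz, rfl⟩ }
  have hmem : ∀ z, e z ∈ N → Submodule.Quotient.mk z ∈ W.toSubmodule := fun z hz => ⟨z, hz, rfl⟩
  rcases eq_bot_or_eq_top W with h | h
  · refine .inr fun n hn => ?_
    have hz := hmem (e.symm n) (by rwa [e.apply_symm_apply])
    rw [h] at hz
    rw [← e.apply_symm_apply n]
    exact localizationTensorEquiv_mem_smul_top ((Submodule.Quotient.mk_eq_zero _).1 hz)
  · refine .inl (eq_top_iff.2 fun m _ => ?_)
    obtain ⟨z, hz, hzm⟩ : Submodule.Quotient.mk (e.symm m) ∈ W.toSubmodule := h ▸ trivial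
    have := hle (localizationTensorEquiv_mem_smul_top ((Submodule.Quotient.eq _).1 hzm))
    rw [map_sub] at this
    have hm := N.sub_mem hz this
    rwa [sub_sub_cancel, LinearEquiv.apply_symm_apply] at hm

end LatticeRep

/-! ### Lattices and the generic fibre -/

/-- Every vector has a nonzero multiple in a lattice. -/
theorem Submodule.IsLattice.exists_smul_mem {R K V : Type*} [CommRing R] [IsDomain R] [Field K]
    [Algebra R K] [IsFractionRing R K] [AddCommGroup V] [Module R V] [Module K V]
    [IsScalarTower R K V] (L : Submodule R V) [hL : L.IsLattice K] (v : V) :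
    ∃ r : R, r ≠ 0 ∧ r • v ∈ L := by
  have hv : v ∈ Submodule.span K (L : Set V) := hL.span_eq_top ▸ Submodule.mem_top
  induction hv using Submodule.span_induction with
  | mem y hy => exact ⟨1, one_ne_zero, by rwa [one_smul]⟩
  | zero => exact ⟨1, one_ne_zero, by simp⟩
  | add a b _ _ ha hb =>
    obtain ⟨r, hr, ha⟩ := ha
    obtain ⟨s, hs, hb⟩ := hb
    refine ⟨r * s, mul_ne_zero hr hs, ?_⟩
    rw [smul_add]
    refine L.add_mem ?_ ?_
    · rw [mul_comm, mul_smul]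
      exact L.smul_mem s ha
    · rw [mul_smul]
      exact L.smul_mem r hb
  | smul c a _ ha =>
    obtain ⟨r, hr, ha⟩ := ha
    obtain ⟨x, y, hy, rfl⟩ := IsFractionRing.div_surjective (A := R) c
    have hy0 : algebraMap R K y ≠ 0 :=
      IsFractionRing.to_map_ne_zero_of_mem_nonZeroDivisors hy
    refine ⟨y * r, mul_ne_zero (nonZeroDivisors.ne_zero hy) hr, ?_⟩
    have : (y * r) • (algebraMap R K x / algebraMap R K y) • a = x • r • a := by
      rw [← algebraMap_smul K (y * r), ← algebraMap_smul K x, ← algebraMap_smul K r, smul_smul,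
        smul_smul, map_mul]
      congr 1
      field_simp
    rw [this]
    exact L.smul_mem x ha

theorem theorem3p7 {R K V G : Type*} [CommRing R] [IsRegularLocalRing R]
    [Field K] [Algebra R K] [IsFractionRing R K] [Group G]
    [AddCommGroup V] [Module R V] [Module K V] [IsScalarTower R K V]
    [FiniteDimensional K V] [Nontrivial V]
    (ρ : Representation K G V) (L : Submodule R V) (hlat : L.IsLattice K)
    (hfree : Module.Free R L) (hstable : ∀ g : G, ∀ v ∈ L, ρ g v ∈ L)
    (hirr : (LatticeRep.reductionAt (LatticeRep.onLattice ρ L hstable)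
      (IsLocalRing.maximalIdeal R)).IsIrreducible) :
    ρ.IsIrreducible := by
  have hdom : IsDomain R := (IsFractionRing.injective R K).isDomain
  have hfin : Module.Finite R L := Module.Finite.iff_fg.2 hlat.fg
  have hnt : Nontrivial (Subrepresentation ρ) :=
    ⟨⊥, ⊤, fun h => bot_ne_top (α := Submodule K V)
      (congrArg Subrepresentation.toSubmodule h)⟩
  refine ⟨fun W => ?_⟩
  -- Nonzero elements of R are invertible in K, so L/(W ∩ L) is torsion-free.
  have hWK : ∀ {r : R}, r ≠ 0 → ∀ {v : V}, r • v ∈ W.toSubmodule → v ∈ W.toSubmodule := by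
    intro r hr v hv
    rw [← algebraMap_smul K] at hv
    exact (W.toSubmodule.smul_mem_iff
      ((map_ne_zero_iff _ (IsFractionRing.injective R K)).2 hr)).1 hv
  rcases (IsRegularLocalRing.hasPrincipalPrimeChain_bot R).eq_top_or_le_smul_top
    (fun g => LatticeRep.onLattice ρ L hstable g)
    (LatticeRep.eq_top_or_le_smul_top_of_reductionAt_isIrreducible _ hirr)
    ((W.toSubmodule.restrictScalars R).comap L.subtype)
    (fun g m hm => W.apply_mem_toSubmodule g hm) (by simp)
    (fun r hr m hm => hWK hr hm) with h | h
  · refine .inr (Subrepresentation.toSubmodule_injective (top_le_iff.1 ?_))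
    change ⊤ ≤ W.toSubmodule
    rw [← hlat.span_eq_top, Submodule.span_le]
    intro v hv
    exact (h ▸ Submodule.mem_top :
      (⟨v, hv⟩ : L) ∈ (W.toSubmodule.restrictScalars R).comap L.subtype)
  · refine .inl (Subrepresentation.toSubmodule_injective (le_bot_iff.1 fun w hw => ?_))
    obtain ⟨r, hr, hrw⟩ := Submodule.IsLattice.exists_smul_mem (K := K) L w
    have hmem : (⟨r • w, hrw⟩ : L) ∈ (W.toSubmodule.restrictScalars R).comap L.subtype :=
      (W.toSubmodule.restrictScalars R).smul_mem r hw
    have h0 := h hmem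
    rw [Submodule.bot_smul, Submodule.mem_bot, Submodule.mk_eq_zero, ← algebraMap_smul K] at h0
    exact (smul_eq_zero.1 h0).resolve_left
      ((map_ne_zero_iff _ (IsFractionRing.injective R K)).2 hr)
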